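/- Let $\Omega\subset\mathbb R^n$ ($n\ge 1$) be a bounded domain, and let $a,b,d,r$ be real numbers with $a+b>0$, $d>0$, $r>0$. Consider the Schnakenberg system $$u_t=\Delta u+r(a-u+u^2v),\qquad v_t=d\,\Delta v+r(b-u^2v)\qquad\text{in }\Omega$$ at its homogeneous steady state $(u_0,v_0)=\big(a+b,\ b/(a+b)^2\big)$, where the deviation from the steady state satisfies either homogeneous Dirichlet or homogeneous Neumann boundary conditions. Let $A=(a_{ij})$ be the Jacobian matrix of the reaction terms at $(u_0,v_0)$, and let $$L(u,v)=(\Delta u+a_{11}u+a_{12}v,\ d\,\Delta v+a_{21}u+a_{22}v)$$ be the linearized operator on the pairs of (complex-valued) functions in $H^2(\Omega)$ that satisfy the boundary condition: in the Dirichlet case membership in $H^1_0(\Omega)$; in the Neumann case $\int_\Omega(\Delta w\,\varphi+\nabla w\cdot\nabla\varphi)\,dx=0$ for all $\varphi\in H^1(\Omega)$, which for regular $\partial\Omega$ says $\partial w/\partial n=0$ on $\partial\Omega$. Eigenvalues of $-\Delta$ refer to the same domain and boundary condition. The system is called *Turing stable* if every eigenvalue of $L$ has negative real part. It *generates Turing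 instability* if every eigenvalue of $A$ has negative real part while $L$ has an eigenvalue with positive real part. Put $$D=rd\,\frac{b-a}{a+b}-r(a+b)^2,\qquad \det A=r^2(a+b)^2,\qquad \beta_\pm=\frac{D\pm\sqrt{D^2-4d\det A}}{2d},$$ $$X=d\,\frac{b-a}{a+b}-(a+b)^2 .$$ If $D^2-4d\det A\le 0$, no real number is regarded as lying strictly between $\beta_-$ and $\beta_+$. Assume $\frac{b-a}{a+b}-(a+b)^2<0$. Then $(u_0,v_0)$ is a steady state, and: 1. If $-\frac{\sqrt{4d}}{r(a+b)}<X<0$, i.e. $\max(d,1)(b-a)<(a+b)^3<d(b-a)+\frac{\sqrt{4d}}{r}$, then the system is Turing stable. 2. If $X>\frac{\sqrt{4d}}{r(a+b)}$, i.e. $b-a<(a+b)^3<d(b-a)-\frac{\sqrt{4d}}{r}$, or $X<-\frac{\sqrt{4d}}{r(a+b)}$, i.e. $\max\big(b-a,\ d(b-a)+\frac{\sqrt{4d}}{r}\big)<(a+b)^3$, then the system generates Turing instability if and only if there is an eigenvalue $\lambda$ of $-\Delta$ with $\beta_-<\lambda<\beta_+$. Here "i.e." asserts the equivalence of the conditions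 under the standing assumptions. The implications in 1 and 2 from the conditions on $X$ also hold with the threshold $\frac{\sqrt{4d}}{r(a+b)}$ replaced by $\sqrt{4d}\,(a+b)$, the value of $|X|$ at which $D^2-4d\det A=0$. -/

import Mathlib

open MeasureTheory Filter Topology
open scoped ContDiff

namespace TuringRD

noncomputable section

/-- The Euclidean space `ℝⁿ`. -/
abbrev Space (n : ℕ) : Type := EuclideanSpace ℝ (Fin n)

/-- The classical partial derivative `∂φ/∂xᵢ` of a complex-valued function on `ℝⁿ`. -/
def partialDeriv {n : ℕ} (i : Fin n) (φ : Space n → ℂ) (x : Space n) : ℂ :=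
  fderiv ℝ φ x (EuclideanSpace.single i 1)

/-- `φ ∈ C_c^∞(Ω)`. -/
structure IsTestFunction {n : ℕ} (Ω : Set (Space n)) (φ : Space n → ℂ) : Prop where
  smooth : ContDiff ℝ ∞ φ
  hasCompactSupport : HasCompactSupport φ
  tsupport_subset : tsupport φ ⊆ Ω

/-- `w ∈ L²(Ω; ℂ)`. -/
def IsL2 {n : ℕ} (Ω : Set (Space n)) (w : Space n → ℂ) : Prop :=
  MemLp w 2 (volume.restrict Ω)

/-- `p` is the weak partial derivative `∂w/∂xᵢ` in `Ω` (both functions are meant to be in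
`L²(Ω)`). -/
def IsWeakPartial {n : ℕ} (Ω : Set (Space n)) (i : Fin n) (w p : Space n → ℂ) : Prop :=
  ∀ φ : Space n → ℂ, IsTestFunction Ω φ →
    ∫ x in Ω, w x * partialDeriv i φ x = - ∫ x in Ω, p x * φ x

/-- `w ∈ H¹(Ω)` and `p = ∇w` (weak gradient). -/
structure IsH1 {n : ℕ} (Ω : Set (Space n)) (w : Space n → ℂ) (p : Fin n → Space n → ℂ) :
    Prop where
  fn_mem : IsL2 Ω w
  grad_mem : ∀ i, IsL2 Ω (p i)
  grad : ∀ i, IsWeakPartial Ω i w (p i)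

/-- `w ∈ H²(Ω)`, `p = ∇w` and `q i j = ∂ⱼ∂ᵢ w` (weak derivatives). -/
structure IsH2 {n : ℕ} (Ω : Set (Space n)) (w : Space n → ℂ) (p : Fin n → Space n → ℂ)
    (q : Fin n → Fin n → Space n → ℂ) : Prop where
  h1 : IsH1 Ω w p
  hess_mem : ∀ i j, IsL2 Ω (q i j)
  hess : ∀ i j, IsWeakPartial Ω j (p i) (q i j)

/-- The two homogeneous boundary conditions: `w = 0` on `∂Ω`, and `∂w/∂n = 0` on `∂Ω`. -/
inductive BoundaryCondition where
  | dirichlet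
  | neumann

/-- The boundary condition for a function `w ∈ H²(Ω)` with gradient `p` and Laplacian `l`.
* Dirichlet: `w ∈ H¹₀(Ω)`, the closure of `C_c^∞(Ω)` in `H¹(Ω)`.
* Neumann: the normal trace of `∇w` vanishes, that is, Green's formula
  `∫_Ω (Δw) φ + ∇w · ∇φ = 0` (whose right-hand side is `∫_{∂Ω} (∂w/∂n) φ` when `∂Ω` is regular)
  holds for every `φ ∈ H¹(Ω)`. -/
def SatisfiesBC {n : ℕ} (Ω : Set (Space n)) (w : Space n → ℂ) (p : Fin n → Space n → ℂ)
    (l : Space n → ℂ) : BoundaryCondition → Prop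
  | .dirichlet => ∃ φ : ℕ → Space n → ℂ, (∀ k, IsTestFunction Ω (φ k)) ∧
      Tendsto (fun k => eLpNorm (w - φ k) 2 (volume.restrict Ω)) atTop (𝓝 0) ∧
      ∀ i, Tendsto (fun k => eLpNorm (p i - partialDeriv i (φ k)) 2 (volume.restrict Ω))
        atTop (𝓝 0)
  | .neumann => ∀ (φ : Space n → ℂ) (s : Fin n → Space n → ℂ), IsH1 Ω φ s →
      ∫ x in Ω, (l x * φ x + ∑ i, p i x * s i x) = 0

/-- `w` lies in `H²(Ω)`, satisfies the boundary condition `bc`, and `Δw = l` in `L²(Ω)`: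
the graph of the Laplacian. -/
def IsLaplacian {n : ℕ} (Ω : Set (Space n)) (bc : BoundaryCondition) (w l : Space n → ℂ) :
    Prop :=
  ∃ (p : Fin n → Space n → ℂ) (q : Fin n → Fin n → Space n → ℂ),
    IsH2 Ω w p q ∧ (l =ᵐ[volume.restrict Ω] fun x => ∑ i, q i i x) ∧ SatisfiesBC Ω w p l bc

/-- The real number `lam` is an eigenvalue of `-Δ` on `Ω` with boundary condition `bc`. -/
def IsNegLaplacianEigenvalue {n : ℕ} (Ω : Set (Space n)) (bc : BoundaryCondition) (lam : ℝ) :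
    Prop :=
  ∃ e l : Space n → ℂ, IsLaplacian Ω bc e l ∧ ¬ (e =ᵐ[volume.restrict Ω] 0) ∧
    (fun x => - l x) =ᵐ[volume.restrict Ω] fun x => (lam : ℂ) * e x

/-- A two-component reaction-diffusion system
`∂u/∂t = Du Δu + f(u,v)`, `∂v/∂t = Dv Δv + g(u,v)`. -/
structure RDSystem where
  Du : ℝ
  Dv : ℝ
  f : ℝ → ℝ → ℝ
  g : ℝ → ℝ → ℝ

namespace RDSystem

/-- `(u₀, v₀)` is a spatially homogeneous steady state. -/
def IsSteadyState (S : RDSystem) (u₀ v₀ : ℝ) : Prop :=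
  S.f u₀ v₀ = 0 ∧ S.g u₀ v₀ = 0

/-- The Jacobian matrix of the reaction terms at `(u₀, v₀)`. -/
def jacobian (S : RDSystem) (u₀ v₀ : ℝ) : Matrix (Fin 2) (Fin 2) ℝ :=
  !![deriv (fun s => S.f s v₀) u₀, deriv (fun s => S.f u₀ s) v₀;
     deriv (fun s => S.g s v₀) u₀, deriv (fun s => S.g u₀ s) v₀]

/-- `β` is an eigenvalue of the linearization
`L(u,v) = (Du Δu + a₁₁u + a₁₂v, Dv Δv + a₂₁u + a₂₂v)`, `(aᵢⱼ)` the Jacobian matrix at `(u₀, v₀)`,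
on the pairs of functions in `H²(Ω)` that satisfy the boundary condition `bc`. -/
def IsLinearizedEigenvalue (S : RDSystem) {n : ℕ} (Ω : Set (Space n)) (bc : BoundaryCondition)
    (u₀ v₀ : ℝ) (β : ℂ) : Prop :=
  let A := S.jacobian u₀ v₀
  ∃ u v lu lv : Space n → ℂ, IsLaplacian Ω bc u lu ∧ IsLaplacian Ω bc v lv ∧
    ¬ (u =ᵐ[volume.restrict Ω] 0 ∧ v =ᵐ[volume.restrict Ω] 0) ∧
    ((fun x => (S.Du : ℂ) * lu x + (A 0 0 : ℂ) * u x + (A 0 1 : ℂ) * v x)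
      =ᵐ[volume.restrict Ω] fun x => β * u x) ∧
    ((fun x => (S.Dv : ℂ) * lv x + (A 1 0 : ℂ) * u x + (A 1 1 : ℂ) * v x)
      =ᵐ[volume.restrict Ω] fun x => β * v x)

/-- The steady state is linearly stable for the system without diffusion: every eigenvalue of the
Jacobian matrix has negative real part. -/
def KineticallyStable (S : RDSystem) (u₀ v₀ : ℝ) : Prop :=
  ∀ z : ℂ, Module.End.HasEigenvalue
    (Matrix.toLin' ((S.jacobian u₀ v₀).map (fun t : ℝ => (t : ℂ)))) z → z.re < 0

/-- Turing stability: every eigenvalue of the linearization of the full system has negative real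
part. -/
def TuringStable (S : RDSystem) {n : ℕ} (Ω : Set (Space n)) (bc : BoundaryCondition)
    (u₀ v₀ : ℝ) : Prop :=
  ∀ β : ℂ, S.IsLinearizedEigenvalue Ω bc u₀ v₀ β → β.re < 0

/-- Turing instability: the steady state is linearly stable without diffusion, but the
linearization of the full system has an eigenvalue with positive real part. -/
def TuringUnstable (S : RDSystem) {n : ℕ} (Ω : Set (Space n)) (bc : BoundaryCondition)
    (u₀ v₀ : ℝ) : Prop :=
  S.KineticallyStable u₀ v₀ ∧ ∃ β : ℂ, S.IsLinearizedEigenvalue Ω bc u₀ v₀ β ∧ 0 < β.re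

end RDSystem

/-- The Schnakenberg system
`∂u/∂t = Δu + r(a - u + u²v)`, `∂v/∂t = dΔv + r(b - u²v)`. -/
def schnakenberg (a b d r : ℝ) : RDSystem where
  Du := 1
  Dv := d
  f u v := r * (a - u + u ^ 2 * v)
  g u v := r * (b - u ^ 2 * v)

/-- `D = rd(b-a)/(a+b) - r(a+b)²`. -/
def schD (a b d r : ℝ) : ℝ := r * d * ((b - a) / (a + b)) - r * (a + b) ^ 2

/-- `det A = r²(a+b)²`. -/
def schDet (a b r : ℝ) : ℝ := r ^ 2 * (a + b) ^ 2

/-- `β₋ = (D - √(D² - 4d det A)) / (2d)`. The real square root of a negative number is `0` here, so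
that no real number lies strictly between `β₋` and `β₊` when the two are not real. -/
def betaMinus (a b d r : ℝ) : ℝ :=
  (schD a b d r - √(schD a b d r ^ 2 - 4 * d * schDet a b r)) / (2 * d)

/-- `β₊ = (D + √(D² - 4d det A)) / (2d)`. -/
def betaPlus (a b d r : ℝ) : ℝ :=
  (schD a b d r + √(schD a b d r ^ 2 - 4 * d * schDet a b r)) / (2 * d)

end

end TuringRD

open TuringRD

namespace TuringRD

open scoped ComplexConjugate

/-!
By Green's formula the eigenvalues of `Δ` are real and nonpositive. If `Δw = Mw` for a pair `w` of
functions and a constant matrix `M`, then the Cayley–Hamilton theorem turns `w` into an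
eigenfunction of `Δ` whose eigenvalue is an eigenvalue of `M`. Hence the eigenvalues of `L` are
exactly those of the `2 × 2` matrices `A - λ diag(1, d)`, `λ` running through the eigenvalues of
`-Δ`. The trace of these matrices is negative for `λ ≥ 0`, so stability is decided by the sign of
the determinant `dλ² - Dλ + det A`. It is negative exactly between `β₋` and `β₊`, and by the AM-GM
inequality positive on `λ ≥ 0` as soon as `D < √(4d det A)`, that is, `X < √(4d)(a + b)`.
-/

section TestFunctions

variable {n : ℕ} {Ω : Set (Space n)} {φ ψ : Space n → ℂ}

theorem IsTestFunction.isL2 (hφ : IsTestFunction Ω φ) : IsL2 Ω φ :=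
  hφ.smooth.continuous.memLp_of_hasCompactSupport hφ.hasCompactSupport

theorem IsTestFunction.isL2_partialDeriv (hφ : IsTestFunction Ω φ) (i : Fin n) :
    IsL2 Ω (partialDeriv i φ) :=
  ((hφ.smooth.continuous_fderiv (by simp)).clm_apply
    continuous_const).memLp_of_hasCompactSupport (hφ.hasCompactSupport.fderiv_apply ℝ _)

protected theorem IsTestFunction.star (hφ : IsTestFunction Ω φ) : IsTestFunction Ω (star φ) where
  smooth := Complex.conjCLE.contDiff.comp hφ.smooth
  hasCompactSupport := hφ.hasCompactSupport.comp_left (star_zero ℂ)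
  tsupport_subset := (tsupport_comp_subset (star_zero ℂ) φ).trans hφ.tsupport_subset

theorem partialDeriv_star (i : Fin n) (φ : Space n → ℂ) :
    partialDeriv i (star φ) = star (partialDeriv i φ) := by
  ext x
  exact DFunLike.congr_fun (fderiv_star (f := φ) (x := x)) _

theorem IsTestFunction.smul_add_smul (hφ : IsTestFunction Ω φ) (hψ : IsTestFunction Ω ψ)
    (α β : ℂ) : IsTestFunction Ω (α • φ + β • ψ) where
  smooth := (hφ.smooth.const_smul α).add (hψ.smooth.const_smul β)
  hasCompactSupport := hφ.hasCompactSupport.smul_left.add hψ.hasCompactSupport.smul_left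
  tsupport_subset := (tsupport_add _ _).trans <| Set.union_subset
    ((tsupport_smul_subset_right (fun _ => α) φ).trans hφ.tsupport_subset)
    ((tsupport_smul_subset_right (fun _ => β) ψ).trans hψ.tsupport_subset)

theorem partialDeriv_smul_add_smul (hφ : Differentiable ℝ φ) (hψ : Differentiable ℝ ψ)
    (i : Fin n) (α β : ℂ) :
    partialDeriv i (α • φ + β • ψ) = α • partialDeriv i φ + β • partialDeriv i ψ := by
  ext x
  simp [partialDeriv, fderiv_add ((hφ x).const_smul α) ((hψ x).const_smul β),
    fderiv_const_smul (hφ x), fderiv_const_smul (hψ x)]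

end TestFunctions

section LpConvergence

variable {X ι E : Type*} [MeasurableSpace X] {μ : Measure X} [NormedAddCommGroup E]
  {l : Filter ι} {f g : X → E} {F G : ι → X → E}

theorem tendsto_eLpNorm_sub_iff_tendsto_toLp {p : ENNReal} [Fact (1 ≤ p)]
    (hf : MemLp f p μ) (hF : ∀ k, MemLp (F k) p μ) :
    Tendsto (fun k => eLpNorm (f - F k) p μ) l (𝓝 0) ↔
      Tendsto (fun k => (hF k).toLp) l (𝓝 hf.toLp) := by
  simp only [eLpNorm_sub_comm f]
  exact (Lp.tendsto_Lp_iff_tendsto_eLpNorm'' F hF f hf).symm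

theorem tendsto_eLpNorm_sub_smul_add_smul {𝕜 : Type*} [NormedRing 𝕜] [Module 𝕜 E]
    [IsBoundedSMul 𝕜 E] {p : ENNReal} [Fact (1 ≤ p)]
    (hf : MemLp f p μ) (hg : MemLp g p μ) (hF : ∀ k, MemLp (F k) p μ) (hG : ∀ k, MemLp (G k) p μ)
    (hfF : Tendsto (fun k => eLpNorm (f - F k) p μ) l (𝓝 0))
    (hgG : Tendsto (fun k => eLpNorm (g - G k) p μ) l (𝓝 0)) (α β : 𝕜) :
    Tendsto (fun k => eLpNorm (α • f + β • g - (α • F k + β • G k)) p μ) l (𝓝 0) := by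
  rw [tendsto_eLpNorm_sub_iff_tendsto_toLp hf hF] at hfF
  rw [tendsto_eLpNorm_sub_iff_tendsto_toLp hg hG] at hgG
  exact (tendsto_eLpNorm_sub_iff_tendsto_toLp ((hf.const_smul α).add (hg.const_smul β))
    fun k => ((hF k).const_smul α).add ((hG k).const_smul β)).2
    ((hfF.const_smul α).add (hgG.const_smul β))

theorem tendsto_integral_inner {𝕜 : Type*} [RCLike 𝕜] [InnerProductSpace 𝕜 E]
    (hf : MemLp f 2 μ) (hg : MemLp g 2 μ) (hF : ∀ k, MemLp (F k) 2 μ)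
    (hfF : Tendsto (fun k => eLpNorm (f - F k) 2 μ) l (𝓝 0)) :
    Tendsto (fun k => ∫ x, inner 𝕜 (F k x) (g x) ∂μ) l (𝓝 (∫ x, inner 𝕜 (f x) (g x) ∂μ)) := by
  have integral_inner_eq {h : X → E} (hh : MemLp h 2 μ) :
      ∫ x, inner 𝕜 (h x) (g x) ∂μ = inner 𝕜 hh.toLp hg.toLp := by
    rw [L2.inner_def]
    refine integral_congr_ae ?_
    filter_upwards [hh.coeFn_toLp, hg.coeFn_toLp] with x hx hgx
    rw [hx, hgx]
  simp only [integral_inner_eq hf, integral_inner_eq (hF _)]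
  exact ((tendsto_eLpNorm_sub_iff_tendsto_toLp hf hF).1 hfF).inner tendsto_const_nhds

end LpConvergence

section Linearity

variable {n : ℕ} {Ω : Set (Space n)} {u v lu lv : Space n → ℂ} {p p' : Fin n → Space n → ℂ}
  {q q' : Fin n → Fin n → Space n → ℂ}

theorem IsL2.smul_add_smul (hu : IsL2 Ω u) (hv : IsL2 Ω v) (α β : ℂ) :
    IsL2 Ω (α • u + β • v) :=
  (MemLp.const_smul hu α).add (MemLp.const_smul hv β)

protected theorem IsL2.star (hu : IsL2 Ω u) : IsL2 Ω (star u) :=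
  MemLp.star hu

theorem IsL2.integrable_mul (hu : IsL2 Ω u) (hv : IsL2 Ω v) :
    Integrable (fun x => u x * v x) (volume.restrict Ω) :=
  MemLp.integrable_mul hu hv

theorem IsL2.integral_smul_add_smul_mul {w : Space n → ℂ} (hu : IsL2 Ω u) (hv : IsL2 Ω v)
    (hw : IsL2 Ω w) (α β : ℂ) :
    ∫ x in Ω, (α • u + β • v) x * w x =
      α * (∫ x in Ω, u x * w x) + β * ∫ x in Ω, v x * w x := by
  rw [← integral_const_mul, ← integral_const_mul,
    ← integral_add ((hu.integrable_mul hw).const_mul α) ((hv.integrable_mul hw).const_mul β)]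
  simp only [Pi.add_apply, Pi.smul_apply, smul_eq_mul, add_mul, mul_assoc]

theorem IsWeakPartial.smul_add_smul {i : Fin n} {pu pv : Space n → ℂ} (hu : IsL2 Ω u)
    (hv : IsL2 Ω v) (hpu : IsL2 Ω pu) (hpv : IsL2 Ω pv) (hupu : IsWeakPartial Ω i u pu)
    (hvpv : IsWeakPartial Ω i v pv) (α β : ℂ) :
    IsWeakPartial Ω i (α • u + β • v) (α • pu + β • pv) := by
  intro φ hφ
  rw [hu.integral_smul_add_smul_mul hv (hφ.isL2_partialDeriv i),
    hpu.integral_smul_add_smul_mul hpv hφ.isL2, hupu φ hφ, hvpv φ hφ]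
  ring

protected theorem IsWeakPartial.star {i : Fin n} {pu : Space n → ℂ}
    (h : IsWeakPartial Ω i u pu) : IsWeakPartial Ω i (star u) (star pu) := by
  intro φ hφ
  simpa [← integral_conj, partialDeriv_star] using congrArg (starRingEnd ℂ) (h _ hφ.star)

theorem IsH1.smul_add_smul (hu : IsH1 Ω u p) (hv : IsH1 Ω v p') (α β : ℂ) :
    IsH1 Ω (α • u + β • v) (α • p + β • p') where
  fn_mem := hu.fn_mem.smul_add_smul hv.fn_mem α β
  grad_mem i := (hu.grad_mem i).smul_add_smul (hv.grad_mem i) α β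
  grad i := (hu.grad i).smul_add_smul hu.fn_mem hv.fn_mem (hu.grad_mem i) (hv.grad_mem i)
    (hv.grad i) α β

protected theorem IsH1.star (hu : IsH1 Ω u p) : IsH1 Ω (star u) (star p) where
  fn_mem := hu.fn_mem.star
  grad_mem i := (hu.grad_mem i).star
  grad i := (hu.grad i).star

theorem IsH2.smul_add_smul (hu : IsH2 Ω u p q) (hv : IsH2 Ω v p' q') (α β : ℂ) :
    IsH2 Ω (α • u + β • v) (α • p + β • p') (α • q + β • q') where
  h1 := hu.h1.smul_add_smul hv.h1 α β
  hess_mem i j := (hu.hess_mem i j).smul_add_smul (hv.hess_mem i j) α β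
  hess i j := (hu.hess i j).smul_add_smul (hu.h1.grad_mem i) (hv.h1.grad_mem i)
    (hu.hess_mem i j) (hv.hess_mem i j) (hv.hess i j) α β

theorem IsH2.isL2_laplacian (hu : IsH2 Ω u p q)
    (hlu : lu =ᵐ[volume.restrict Ω] fun x => ∑ i, q i i x) : IsL2 Ω lu :=
  (memLp_congr_ae hlu).2 (memLp_finsetSum _ fun i _ => hu.hess_mem i i)

theorem SatisfiesBC.dirichlet_smul_add_smul (hu : IsH1 Ω u p) (hv : IsH1 Ω v p')
    (hbu : SatisfiesBC Ω u p lu .dirichlet) (hbv : SatisfiesBC Ω v p' lv .dirichlet) (α β : ℂ) :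
    SatisfiesBC Ω (α • u + β • v) (α • p + β • p') (α • lu + β • lv) .dirichlet := by
  obtain ⟨φ, hφ, hφu, hφp⟩ := hbu
  obtain ⟨ψ, hψ, hψv, hψp⟩ := hbv
  refine ⟨fun k => α • φ k + β • ψ k, fun k => (hφ k).smul_add_smul (hψ k) α β,
    tendsto_eLpNorm_sub_smul_add_smul hu.fn_mem hv.fn_mem (fun k => (hφ k).isL2)
      (fun k => (hψ k).isL2) hφu hψv α β, fun i => ?_⟩
  simp only [partialDeriv_smul_add_smul ((hφ _).smooth.differentiable (by simp))
    ((hψ _).smooth.differentiable (by simp))]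
  exact tendsto_eLpNorm_sub_smul_add_smul (hu.grad_mem i) (hv.grad_mem i)
    (fun k => (hφ k).isL2_partialDeriv i) (fun k => (hψ k).isL2_partialDeriv i) (hφp i) (hψp i) α β

theorem integral_mul_add_sum {w l : Space n → ℂ} {s : Fin n → Space n → ℂ} (hl : IsL2 Ω l)
    (hp : ∀ i, IsL2 Ω (p i)) (hw : IsL2 Ω w) (hs : ∀ i, IsL2 Ω (s i)) :
    ∫ x in Ω, (l x * w x + ∑ i, p i x * s i x) =
      (∫ x in Ω, l x * w x) + ∑ i, ∫ x in Ω, p i x * s i x := by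
  rw [integral_add (hl.integrable_mul hw)
    (integrable_finsetSum _ fun i _ => (hp i).integrable_mul (hs i)),
    integral_finsetSum _ fun i _ => (hp i).integrable_mul (hs i)]

theorem SatisfiesBC.neumann_smul_add_smul (hlu : IsL2 Ω lu) (hlv : IsL2 Ω lv)
    (hp : ∀ i, IsL2 Ω (p i)) (hp' : ∀ i, IsL2 Ω (p' i))
    (hbu : SatisfiesBC Ω u p lu .neumann) (hbv : SatisfiesBC Ω v p' lv .neumann) (α β : ℂ) :
    SatisfiesBC Ω (α • u + β • v) (α • p + β • p') (α • lu + β • lv) .neumann := by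
  intro φ s hφ
  have green_u := hbu φ s hφ
  have green_v := hbv φ s hφ
  rw [integral_mul_add_sum hlu hp hφ.fn_mem hφ.grad_mem] at green_u
  rw [integral_mul_add_sum hlv hp' hφ.fn_mem hφ.grad_mem] at green_v
  have integral_grad (i : Fin n) : ∫ x in Ω, (α • p + β • p') i x * s i x =
      α * (∫ x in Ω, p i x * s i x) + β * ∫ x in Ω, p' i x * s i x :=
    (hp i).integral_smul_add_smul_mul (hp' i) (hφ.grad_mem i) α β
  rw [integral_mul_add_sum (p := α • p + β • p') (hlu.smul_add_smul hlv α β)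
    (fun i => (hp i).smul_add_smul (hp' i) α β) hφ.fn_mem hφ.grad_mem,
    hlu.integral_smul_add_smul_mul hlv hφ.fn_mem]
  simp only [integral_grad, Finset.sum_add_distrib, ← Finset.mul_sum]
  linear_combination α * green_u + β * green_v

variable {bc : BoundaryCondition}

theorem IsLaplacian.isL2 (hu : IsLaplacian Ω bc u lu) : IsL2 Ω u := by
  obtain ⟨p, q, h2, -⟩ := hu
  exact h2.h1.fn_mem

theorem IsLaplacian.smul_add_smul (hu : IsLaplacian Ω bc u lu) (hv : IsLaplacian Ω bc v lv)
    (α β : ℂ) : IsLaplacian Ω bc (α • u + β • v) (α • lu + β • lv) := by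
  obtain ⟨p, q, hu2, hlu, hbu⟩ := hu
  obtain ⟨p', q', hv2, hlv, hbv⟩ := hv
  refine ⟨_, _, hu2.smul_add_smul hv2 α β, ?_, ?_⟩
  · filter_upwards [hlu, hlv] with x hx hx'
    simp [hx, hx', Finset.mul_sum, Finset.sum_add_distrib]
  · cases bc with
    | dirichlet => exact hbu.dirichlet_smul_add_smul hu2.h1 hv2.h1 hbv α β
    | neumann =>
      exact hbu.neumann_smul_add_smul (hu2.isL2_laplacian hlu) (hv2.isL2_laplacian hlv)
        hu2.h1.grad_mem hv2.h1.grad_mem hbv α β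

theorem IsLaplacian.const_smul (hu : IsLaplacian Ω bc u lu) (α : ℂ) :
    IsLaplacian Ω bc (α • u) (α • lu) := by
  simpa using hu.smul_add_smul hu α 0

end Linearity

section Green

variable {n : ℕ} {Ω : Set (Space n)} {bc : BoundaryCondition} {w l : Space n → ℂ}
  {p : Fin n → Space n → ℂ} {q : Fin n → Fin n → Space n → ℂ}

theorem IsH2.integral_laplacian_mul_testFunction (hw : IsH2 Ω w p q)
    (hl : l =ᵐ[volume.restrict Ω] fun x => ∑ i, q i i x) {φ : Space n → ℂ}
    (hφ : IsTestFunction Ω φ) :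
    ∫ x in Ω, l x * φ x = -∑ i, ∫ x in Ω, p i x * partialDeriv i φ x := by
  calc ∫ x in Ω, l x * φ x = ∫ x in Ω, ∑ i, q i i x * φ x :=
        integral_congr_ae <| by
          filter_upwards [hl] with x hx
          rw [hx, Finset.sum_mul]
    _ = ∑ i, ∫ x in Ω, q i i x * φ x :=
        integral_finsetSum _ fun i _ => (hw.hess_mem i i).integrable_mul hφ.isL2
    _ = -∑ i, ∫ x in Ω, p i x * partialDeriv i φ x := by
        simp only [hw.hess _ _ φ hφ, Finset.sum_neg_distrib, neg_neg]

theorem IsH2.green_dirichlet (hw : IsH2 Ω w p q)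
    (hl : l =ᵐ[volume.restrict Ω] fun x => ∑ i, q i i x)
    (hbc : SatisfiesBC Ω w p l .dirichlet) :
    ∫ x in Ω, l x * conj (w x) = -∑ i, ∫ x in Ω, p i x * conj (p i x) := by
  obtain ⟨φ, hφ, hφw, hφp⟩ := hbc
  have tendsto_lhs : Tendsto (fun k => ∫ x in Ω, l x * conj (φ k x)) atTop
      (𝓝 (∫ x in Ω, l x * conj (w x))) :=
    tendsto_integral_inner (𝕜 := ℂ) hw.h1.fn_mem (hw.isL2_laplacian hl)
      (fun k => (hφ k).isL2) hφw
  have tendsto_rhs : Tendsto (fun k => -∑ i, ∫ x in Ω, p i x * conj (partialDeriv i (φ k) x))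
      atTop (𝓝 (-∑ i, ∫ x in Ω, p i x * conj (p i x))) :=
    (tendsto_finsetSum _ fun i _ => tendsto_integral_inner (𝕜 := ℂ) (hw.h1.grad_mem i)
      (hw.h1.grad_mem i) (fun k => (hφ k).isL2_partialDeriv i) (hφp i)).neg
  refine tendsto_nhds_unique tendsto_lhs (tendsto_rhs.congr fun k => ?_)
  simpa [partialDeriv_star] using (hw.integral_laplacian_mul_testFunction hl (hφ k).star).symm

theorem IsH2.green_neumann (hw : IsH2 Ω w p q)
    (hl : l =ᵐ[volume.restrict Ω] fun x => ∑ i, q i i x)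
    (hbc : SatisfiesBC Ω w p l .neumann) :
    ∫ x in Ω, l x * conj (w x) = -∑ i, ∫ x in Ω, p i x * conj (p i x) := by
  have h := hbc _ _ hw.h1.star
  rw [integral_mul_add_sum (hw.isL2_laplacian hl) hw.h1.grad_mem hw.h1.star.fn_mem
    hw.h1.star.grad_mem] at h
  exact eq_neg_of_add_eq_zero_left h

theorem integral_mul_conj_self (w : Space n → ℂ) :
    ∫ x in Ω, w x * conj (w x) = ((∫ x in Ω, ‖w x‖ ^ 2 : ℝ) : ℂ) := by
  rw [← integral_complex_ofReal]
  simp [Complex.mul_conj']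

theorem IsL2.integral_norm_sq_pos (hw : IsL2 Ω w) (hne : ¬ w =ᵐ[volume.restrict Ω] 0) :
    0 < ∫ x in Ω, ‖w x‖ ^ 2 := by
  refine (integral_nonneg fun x => by positivity).lt_of_ne fun h => hne ?_
  have h0 := (integral_eq_zero_iff_of_nonneg (fun x => by positivity)
    ((memLp_two_iff_integrable_sq_norm hw.aestronglyMeasurable).1 hw)).1 h.symm
  filter_upwards [h0] with x hx
  simpa using hx

theorem IsLaplacian.exists_integral_mul_conj_eq_neg (h : IsLaplacian Ω bc w l) :
    ∃ E : ℝ, 0 ≤ E ∧ ∫ x in Ω, l x * conj (w x) = -(E : ℂ) := by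
  obtain ⟨p, q, hw, hl, hbc⟩ := h
  refine ⟨∑ i, ∫ x in Ω, ‖p i x‖ ^ 2, by positivity, ?_⟩
  push_cast [← integral_mul_conj_self]
  cases bc with
  | dirichlet => exact hw.green_dirichlet hl hbc
  | neumann => exact hw.green_neumann hl hbc

theorem IsLaplacian.exists_isNegLaplacianEigenvalue (h : IsLaplacian Ω bc w l)
    (hne : ¬ w =ᵐ[volume.restrict Ω] 0) {μ : ℂ} (hl : l =ᵐ[volume.restrict Ω] μ • w) :
    ∃ lam : ℝ, 0 ≤ lam ∧ IsNegLaplacianEigenvalue Ω bc lam ∧ μ = -(lam : ℂ) := by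
  obtain ⟨E, hE, hgreen⟩ := h.exists_integral_mul_conj_eq_neg
  have hpos := h.isL2.integral_norm_sq_pos hne
  have hμ : μ * (∫ x in Ω, ‖w x‖ ^ 2 : ℝ) = -(E : ℂ) := by
    rw [← hgreen, ← integral_mul_conj_self, ← integral_const_mul]
    refine integral_congr_ae ?_
    filter_upwards [hl] with x hx
    rw [hx, Pi.smul_apply, smul_eq_mul, mul_assoc]
  have hμ' : μ = -((E / ∫ x in Ω, ‖w x‖ ^ 2 : ℝ) : ℂ) := by
    rw [Complex.ofReal_div, ← neg_div, eq_div_iff (by exact_mod_cast hpos.ne'), hμ]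
  refine ⟨_, by positivity, ⟨w, l, h, hne, ?_⟩, hμ'⟩
  filter_upwards [hl] with x hx
  rw [hx, hμ', Pi.smul_apply, smul_eq_mul, neg_mul, neg_neg]

theorem IsNegLaplacianEigenvalue.nonneg {lam : ℝ} (h : IsNegLaplacianEigenvalue Ω bc lam) :
    0 ≤ lam := by
  obtain ⟨e, l, hl, hne, hel⟩ := h
  obtain ⟨lam', hlam', -, heq⟩ := hl.exists_isNegLaplacianEigenvalue hne (μ := -lam) <| by
    filter_upwards [hel] with x hx
    rw [Pi.smul_apply, smul_eq_mul, neg_mul, ← hx, neg_neg]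
  rwa [Complex.ofReal_injective (neg_injective heq)]

end Green

section Quadratic

theorem re_neg_of_quadratic_eq_zero {t c : ℝ} (ht : 0 < t) (hc : 0 < c) {z : ℂ}
    (h : z ^ 2 + t * z + c = 0) : z.re < 0 := by
  have hre : z.re ^ 2 - z.im ^ 2 + t * z.re + c = 0 := by
    simpa [sq] using congrArg Complex.re h
  have him : z.im * (2 * z.re + t) = 0 := by
    have := congrArg Complex.im h
    simp only [sq, Complex.add_im, Complex.mul_im, Complex.ofReal_re, Complex.ofReal_im, zero_mul,
      add_zero, Complex.zero_im] at this
    linarith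
  by_contra! hz
  have him0 : z.im = 0 := (mul_eq_zero.1 him).resolve_right (by positivity)
  rw [him0] at hre
  have : 0 < z.re ^ 2 + t * z.re + c := by positivity
  linarith

theorem exists_quadratic_root_re_pos_iff {t c : ℝ} (ht : 0 < t) :
    (∃ z : ℂ, z ^ 2 + t * z + c = 0 ∧ 0 < z.re) ↔ c < 0 := by
  constructor
  · rintro ⟨z, h, hz⟩
    by_contra! hc
    rcases hc.eq_or_lt with rfl | hc
    · have hfac : z * (z + t) = 0 := by
        rw [Complex.ofReal_zero] at h
        linear_combination h
      have hz0 : z ≠ 0 := by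
        rintro rfl
        simp at hz
      have hzt : z = ((-t : ℝ) : ℂ) := by
        rw [Complex.ofReal_neg]
        exact eq_neg_of_add_eq_zero_left ((mul_eq_zero.1 hfac).resolve_left hz0)
      rw [hzt, Complex.ofReal_re] at hz
      linarith
    · exact (re_neg_of_quadratic_eq_zero ht hc h).not_gt hz
  · intro hc
    have hsq : √(t ^ 2 - 4 * c) ^ 2 = t ^ 2 - 4 * c := Real.sq_sqrt (by nlinarith)
    have hlt : t < √(t ^ 2 - 4 * c) := Real.lt_sqrt_of_sq_lt (by linarith)
    refine ⟨((√(t ^ 2 - 4 * c) - t) / 2 : ℝ), ?_, ?_⟩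
    · norm_cast
      linear_combination hsq / 4
    · rw [Complex.ofReal_re]
      linarith

theorem quadratic_neg_iff {d D c x : ℝ} (hd : 0 < d) :
    d * x ^ 2 - D * x + c < 0 ↔
      (D - √(D ^ 2 - 4 * d * c)) / (2 * d) < x ∧ x < (D + √(D ^ 2 - 4 * d * c)) / (2 * d) := by
  have complete_square : d * x ^ 2 - D * x + c < 0 ↔
      (2 * d * x - D) ^ 2 < D ^ 2 - 4 * d * c := by
    rw [← mul_lt_mul_iff_right₀ (show 0 < 4 * d by positivity)]
    constructor <;> intro h <;> linarith
  rw [complete_square, Real.sq_lt, div_lt_iff₀ (by positivity), lt_div_iff₀ (by positivity)]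
  constructor <;> rintro ⟨h, h'⟩ <;> constructor <;> linarith

theorem quadratic_pos_of_lt_sqrt {d D c x : ℝ} (hd : 0 ≤ d) (hc : 0 < c) (hx : 0 ≤ x)
    (hD : D < √(4 * d * c)) : 0 < d * x ^ 2 - D * x + c := by
  have am_gm : √(4 * d * c) * x ≤ d * x ^ 2 + c := by
    refine le_of_sq_le_sq ?_ (by positivity)
    rw [mul_pow, Real.sq_sqrt (by positivity)]
    linarith [sq_nonneg (d * x ^ 2 - c)]
  rcases hx.eq_or_lt with rfl | hx
  · simpa using hc
  · linarith [mul_lt_mul_of_pos_right hD hx]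

end Quadratic

section TwoByTwo

variable {K : Type*} [Field K] {M : Matrix (Fin 2) (Fin 2) K} {μ : K}

theorem hasEigenvalue_toLin'_fin_two_iff :
    Module.End.HasEigenvalue (Matrix.toLin' M) μ ↔ μ ^ 2 - M.trace * μ + M.det = 0 := by
  rw [Module.End.hasEigenvalue_iff_isRoot_charpoly, Matrix.charpoly_toLin',
    Matrix.charpoly_fin_two]
  simp

theorem sub_scalar_mul_self_of_hasEigenvalue (hμ : Module.End.HasEigenvalue (Matrix.toLin' M) μ) :
    (M - Matrix.scalar _ μ) * M = (M.trace - μ) • (M - Matrix.scalar _ μ) := by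
  have hχ := hasEigenvalue_toLin'_fin_two_iff.1 hμ
  have hM : M * M - M.trace • M + M.det • 1 = 0 := by
    simpa [Matrix.charpoly_fin_two, Algebra.algebraMap_eq_smul_one, sq] using M.aeval_self_charpoly
  have hdet : M.det = (M.trace - μ) * μ := by linear_combination hχ
  rw [hdet] at hM
  rw [Matrix.scalar_apply, ← Matrix.smul_one_eq_diagonal, sub_mul, smul_mul_assoc, one_mul,
    ← sub_eq_zero, ← hM]
  module

theorem hasEigenvalue_trace_sub (hμ : Module.End.HasEigenvalue (Matrix.toLin' M) μ) :
    Module.End.HasEigenvalue (Matrix.toLin' M) (M.trace - μ) := by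
  rw [hasEigenvalue_toLin'_fin_two_iff] at hμ ⊢
  linear_combination hμ

/-- `z` is an eigenvalue of the real matrix `A` over `ℂ`. -/
def IsComplexEigenvalue (A : Matrix (Fin 2) (Fin 2) ℝ) (z : ℂ) : Prop :=
  Module.End.HasEigenvalue (Matrix.toLin' (A.map fun t : ℝ => (t : ℂ))) z

variable {A : Matrix (Fin 2) (Fin 2) ℝ} {z : ℂ}

theorem isComplexEigenvalue_iff :
    IsComplexEigenvalue A z ↔ z ^ 2 + (-A.trace : ℝ) * z + A.det = 0 := by
  rw [IsComplexEigenvalue, hasEigenvalue_toLin'_fin_two_iff]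
  simp only [Matrix.trace_fin_two, Matrix.det_fin_two, Matrix.map_apply]
  push_cast
  rw [neg_mul, ← sub_eq_add_neg]

theorem IsComplexEigenvalue.re_neg (htr : A.trace < 0) (hdet : 0 < A.det)
    (hz : IsComplexEigenvalue A z) : z.re < 0 :=
  re_neg_of_quadratic_eq_zero (neg_pos.2 htr) hdet (isComplexEigenvalue_iff.1 hz)

theorem exists_isComplexEigenvalue_re_pos_iff (htr : A.trace < 0) :
    (∃ z, IsComplexEigenvalue A z ∧ 0 < z.re) ↔ A.det < 0 := by
  simp only [isComplexEigenvalue_iff]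
  exact exists_quadratic_root_re_pos_iff (neg_pos.2 htr)

end TwoByTwo

section ReactionDiffusion

variable {n : ℕ} {Ω : Set (Space n)} {bc : BoundaryCondition}

theorem exists_isNegLaplacianEigenvalue_of_pair {M : Matrix (Fin 2) (Fin 2) ℂ}
    {w l : Fin 2 → Space n → ℂ} (hw : ∀ i, IsLaplacian Ω bc (w i) (l i))
    (hne : ∃ i, ¬ w i =ᵐ[volume.restrict Ω] 0)
    (hl : ∀ i, l i =ᵐ[volume.restrict Ω] M i 0 • w 0 + M i 1 • w 1) :
    ∃ lam : ℝ, IsNegLaplacianEigenvalue Ω bc lam ∧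
      Module.End.HasEigenvalue (Matrix.toLin' M) (-lam) := by
  obtain ⟨μ, hμ⟩ := Module.End.exists_eigenvalue (Matrix.toLin' M)
  set N := M - Matrix.scalar (Fin 2) μ with hN
  -- By Cayley–Hamilton, the components of `N w` are eigenfunctions for the other eigenvalue of `M`,
  -- unless they vanish, in which case `Δ w = M w = μ w`.
  by_cases hNw : ∀ i, N i 0 • w 0 + N i 1 • w 1 =ᵐ[volume.restrict Ω] 0
  · obtain ⟨i, hi⟩ := hne
    have hΔ : l i =ᵐ[volume.restrict Ω] μ • w i := by
      filter_upwards [hl i, hNw i] with x hx hNx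
      rw [hx]
      fin_cases i <;> simp [hN] at hNx ⊢ <;> linear_combination hNx
    obtain ⟨lam, -, hlam, rfl⟩ := (hw i).exists_isNegLaplacianEigenvalue hi hΔ
    exact ⟨lam, hlam, hμ⟩
  · obtain ⟨i, hi⟩ := not_forall.1 hNw
    have cayley_hamilton (j : Fin 2) :
        N i 0 * M 0 j + N i 1 * M 1 j = (M.trace - μ) * N i j := by
      have := congrFun₂ (sub_scalar_mul_self_of_hasEigenvalue hμ) i j
      rwa [← hN, Matrix.mul_apply, Fin.sum_univ_two, Matrix.smul_apply, smul_eq_mul] at this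
    have hΔ : N i 0 • l 0 + N i 1 • l 1 =ᵐ[volume.restrict Ω]
        (M.trace - μ) • (N i 0 • w 0 + N i 1 • w 1) := by
      filter_upwards [hl 0, hl 1] with x h0 h1
      simp only [Pi.add_apply, Pi.smul_apply, smul_eq_mul] at h0 h1 ⊢
      rw [h0, h1]
      linear_combination w 0 x * cayley_hamilton 0 + w 1 x * cayley_hamilton 1
    obtain ⟨lam, -, hlam, hμ'⟩ :=
      ((hw 0).smul_add_smul (hw 1) (N i 0) (N i 1)).exists_isNegLaplacianEigenvalue hi hΔ
    exact ⟨lam, hlam, hμ' ▸ hasEigenvalue_trace_sub hμ⟩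

namespace RDSystem

variable (S : RDSystem) {u₀ v₀ : ℝ}

/-- The matrix `A - λ diag(Du, Dv)`, `A` the Jacobian matrix at `(u₀, v₀)`, by which the
linearization acts on the pairs `(c₁e, c₂e)`, where `-Δe = λe`. -/
noncomputable def modeMatrix (u₀ v₀ lam : ℝ) : Matrix (Fin 2) (Fin 2) ℝ :=
  S.jacobian u₀ v₀ - lam • Matrix.diagonal ![S.Du, S.Dv]

theorem trace_modeMatrix (lam : ℝ) :
    (S.modeMatrix u₀ v₀ lam).trace = (S.jacobian u₀ v₀).trace - (S.Du + S.Dv) * lam := by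
  simp [modeMatrix, Matrix.trace_fin_two]
  ring

theorem det_modeMatrix (lam : ℝ) :
    (S.modeMatrix u₀ v₀ lam).det = S.Du * S.Dv * lam ^ 2
      - (S.Dv * S.jacobian u₀ v₀ 0 0 + S.Du * S.jacobian u₀ v₀ 1 1) * lam
      + (S.jacobian u₀ v₀).det := by
  simp [modeMatrix, Matrix.det_fin_two]
  ring

theorem isLinearizedEigenvalue_of_isComplexEigenvalue_modeMatrix {lam : ℝ} {β : ℂ}
    (hlam : IsNegLaplacianEigenvalue Ω bc lam)
    (hβ : IsComplexEigenvalue (S.modeMatrix u₀ v₀ lam) β) :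
    S.IsLinearizedEigenvalue Ω bc u₀ v₀ β := by
  obtain ⟨e, l, hl, hne, hel⟩ := hlam
  obtain ⟨c, hc, hc0⟩ := Module.End.HasEigenvalue.exists_hasEigenvector hβ
  rw [Module.End.mem_eigenspace_iff, Matrix.toLin'_apply] at hc
  set A := S.jacobian u₀ v₀ with hA
  have hc_u : (A 0 0 - lam * S.Du) * c 0 + A 0 1 * c 1 = β * c 0 := by
    simpa [modeMatrix, Matrix.mulVec, dotProduct, ← hA] using congrFun hc 0
  have hc_v : A 1 0 * c 0 + (A 1 1 - lam * S.Dv) * c 1 = β * c 1 := by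
    simpa [modeMatrix, Matrix.mulVec, dotProduct, ← hA] using congrFun hc 1
  have hle : ∀ᵐ x ∂volume.restrict Ω, l x = -(lam * e x) := by
    filter_upwards [hel] with x hx
    rw [← hx, neg_neg]
  refine ⟨c 0 • e, c 1 • e, c 0 • l, c 1 • l, hl.const_smul _, hl.const_smul _, ?_, ?_, ?_⟩
  · rintro ⟨hu, hv⟩
    refine hc0 (funext fun i => by_contra fun hi => hne ?_)
    fin_cases i
    · filter_upwards [hu] with x hx using (mul_eq_zero.1 hx).resolve_left hi
    · filter_upwards [hv] with x hx using (mul_eq_zero.1 hx).resolve_left hi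
  · filter_upwards [hle] with x hx
    simp only [Pi.smul_apply, smul_eq_mul, hx]
    linear_combination e x * hc_u
  · filter_upwards [hle] with x hx
    simp only [Pi.smul_apply, smul_eq_mul, hx]
    linear_combination e x * hc_v

theorem isLinearizedEigenvalue_iff (hDu : S.Du ≠ 0) (hDv : S.Dv ≠ 0) {β : ℂ} :
    S.IsLinearizedEigenvalue Ω bc u₀ v₀ β ↔ ∃ lam : ℝ, IsNegLaplacianEigenvalue Ω bc lam ∧
      IsComplexEigenvalue (S.modeMatrix u₀ v₀ lam) β := by
  refine ⟨?_, fun ⟨lam, hlam, hβ⟩ =>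
    S.isLinearizedEigenvalue_of_isComplexEigenvalue_modeMatrix hlam hβ⟩
  rintro ⟨u, v, lu, lv, hu, hv, hne, hu_eq, hv_eq⟩
  have hU : (S.Du : ℂ) ≠ 0 := by exact_mod_cast hDu
  have hV : (S.Dv : ℂ) ≠ 0 := by exact_mod_cast hDv
  set A := S.jacobian u₀ v₀ with hA
  obtain ⟨lam, hlam, hM⟩ := exists_isNegLaplacianEigenvalue_of_pair (w := ![u, v]) (l := ![lu, lv])
    (M := !![(β - A 0 0) / S.Du, -A 0 1 / S.Du; -A 1 0 / S.Dv, (β - A 1 1) / S.Dv])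
    (Fin.forall_fin_two.2 ⟨hu, hv⟩)
    (by rw [Fin.exists_fin_two]; exact not_and_or.1 hne)
    (Fin.forall_fin_two.2 ⟨by
      filter_upwards [hu_eq] with x hx
      simp
      field_simp
      linear_combination hx, by
      filter_upwards [hv_eq] with x hx
      simp
      field_simp
      linear_combination hx⟩)
  refine ⟨lam, hlam, ?_⟩
  rw [hasEigenvalue_toLin'_fin_two_iff, Matrix.trace_fin_two_of, Matrix.det_fin_two_of] at hM
  rw [isComplexEigenvalue_iff, det_modeMatrix, trace_modeMatrix, Matrix.trace_fin_two,
    Matrix.det_fin_two, ← hA]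
  field_simp at hM
  push_cast
  linear_combination hM

theorem kineticallyStable_of_trace_neg_of_det_pos (htr : (S.jacobian u₀ v₀).trace < 0)
    (hdet : 0 < (S.jacobian u₀ v₀).det) : S.KineticallyStable u₀ v₀ :=
  fun _ hz => IsComplexEigenvalue.re_neg htr hdet hz

variable {S}

theorem trace_modeMatrix_neg (hDu : 0 < S.Du) (hDv : 0 < S.Dv)
    (htr : (S.jacobian u₀ v₀).trace < 0) {lam : ℝ} (hlam : 0 ≤ lam) :
    (S.modeMatrix u₀ v₀ lam).trace < 0 := by
  rw [trace_modeMatrix]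
  have : 0 ≤ (S.Du + S.Dv) * lam := by positivity
  linarith

theorem turingStable_of_det_modeMatrix_pos (hDu : 0 < S.Du) (hDv : 0 < S.Dv)
    (htr : (S.jacobian u₀ v₀).trace < 0)
    (hdet : ∀ lam, IsNegLaplacianEigenvalue Ω bc lam → 0 < (S.modeMatrix u₀ v₀ lam).det) :
    S.TuringStable Ω bc u₀ v₀ := by
  intro β hβ
  obtain ⟨lam, hlam, hβ⟩ := (S.isLinearizedEigenvalue_iff hDu.ne' hDv.ne').1 hβ
  exact hβ.re_neg (trace_modeMatrix_neg hDu hDv htr hlam.nonneg) (hdet lam hlam)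

theorem turingUnstable_iff_exists_det_modeMatrix_neg (hDu : 0 < S.Du) (hDv : 0 < S.Dv)
    (htr : (S.jacobian u₀ v₀).trace < 0) (hdet : 0 < (S.jacobian u₀ v₀).det) :
    S.TuringUnstable Ω bc u₀ v₀ ↔
      ∃ lam, IsNegLaplacianEigenvalue Ω bc lam ∧ (S.modeMatrix u₀ v₀ lam).det < 0 := by
  rw [TuringUnstable, and_iff_right (S.kineticallyStable_of_trace_neg_of_det_pos htr hdet)]
  calc (∃ β, S.IsLinearizedEigenvalue Ω bc u₀ v₀ β ∧ 0 < β.re)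
      ↔ ∃ lam, IsNegLaplacianEigenvalue Ω bc lam ∧
          ∃ β, IsComplexEigenvalue (S.modeMatrix u₀ v₀ lam) β ∧ 0 < β.re := by
        simp only [S.isLinearizedEigenvalue_iff hDu.ne' hDv.ne']
        tauto
    _ ↔ _ := exists_congr fun lam => and_congr_right fun hlam =>
        exists_isComplexEigenvalue_re_pos_iff (trace_modeMatrix_neg hDu hDv htr hlam.nonneg)

end RDSystem

end ReactionDiffusion

section Schnakenberg

variable {a b d r : ℝ}

theorem schnakenberg_isSteadyState (hab : a + b ≠ 0) :
    (schnakenberg a b d r).IsSteadyState (a + b) (b / (a + b) ^ 2) := by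
  constructor <;> simp only [schnakenberg] <;> field_simp <;> ring

theorem schnakenberg_jacobian (u v : ℝ) :
    (schnakenberg a b d r).jacobian u v =
      !![r * (2 * u * v - 1), r * u ^ 2; -(r * (2 * u * v)), -(r * u ^ 2)] := by
  have hasDerivAt_sq_mul : HasDerivAt (fun s => s ^ 2 * v) (2 * u * v) u := by
    simpa using (hasDerivAt_pow 2 u).mul_const v
  have hasDerivAt_mul : HasDerivAt (fun s => u ^ 2 * s) (u ^ 2) v := by
    simpa using (hasDerivAt_id v).const_mul (u ^ 2)
  have hfu : HasDerivAt (fun s => r * (a - s + s ^ 2 * v)) (r * (2 * u * v - 1)) u :=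
    ((((hasDerivAt_id u).const_sub a).add hasDerivAt_sq_mul).const_mul r).congr_deriv (by ring)
  have hfv : HasDerivAt (fun s => r * (a - u + u ^ 2 * s)) (r * u ^ 2) v :=
    (hasDerivAt_mul.const_add (a - u)).const_mul r
  have hgu : HasDerivAt (fun s => r * (b - s ^ 2 * v)) (-(r * (2 * u * v))) u :=
    ((hasDerivAt_sq_mul.const_sub b).const_mul r).congr_deriv (by ring)
  have hgv : HasDerivAt (fun s => r * (b - u ^ 2 * s)) (-(r * u ^ 2)) v :=
    ((hasDerivAt_mul.const_sub b).const_mul r).congr_deriv (by ring)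
  simp only [RDSystem.jacobian, schnakenberg, hfu.deriv, hfv.deriv, hgu.deriv, hgv.deriv]

theorem schnakenberg_jacobian_steadyState (hab : a + b ≠ 0) :
    (schnakenberg a b d r).jacobian (a + b) (b / (a + b) ^ 2) =
      !![r * ((b - a) / (a + b)), r * (a + b) ^ 2;
        -(2 * r * b / (a + b)), -(r * (a + b) ^ 2)] := by
  rw [schnakenberg_jacobian]
  congr! 3
  all_goals field_simp
  ring

theorem trace_schnakenberg_jacobian (hab : a + b ≠ 0) :
    ((schnakenberg a b d r).jacobian (a + b) (b / (a + b) ^ 2)).trace =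
      r * ((b - a) / (a + b) - (a + b) ^ 2) := by
  rw [schnakenberg_jacobian_steadyState hab, Matrix.trace_fin_two_of]
  ring

theorem det_schnakenberg_jacobian (hab : a + b ≠ 0) :
    ((schnakenberg a b d r).jacobian (a + b) (b / (a + b) ^ 2)).det = schDet a b r := by
  rw [schnakenberg_jacobian_steadyState hab, Matrix.det_fin_two_of, schDet]
  field_simp
  ring

theorem det_schnakenberg_modeMatrix (hab : a + b ≠ 0) (lam : ℝ) :
    ((schnakenberg a b d r).modeMatrix (a + b) (b / (a + b) ^ 2) lam).det =
      d * lam ^ 2 - schD a b d r * lam + schDet a b r := by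
  rw [RDSystem.det_modeMatrix, det_schnakenberg_jacobian hab,
    schnakenberg_jacobian_steadyState hab]
  simp only [schnakenberg, schD, Matrix.of_apply, Matrix.cons_val_zero, Matrix.cons_val_one]
  ring

theorem schDet_pos (hab : a + b ≠ 0) (hr : r ≠ 0) : 0 < schDet a b r := by
  rw [schDet]
  positivity

theorem schD_lt_sqrt_schDet (hab : 0 < a + b) (hr : 0 < r)
    (hX : d * ((b - a) / (a + b)) - (a + b) ^ 2 < √(4 * d) * (a + b)) :
    schD a b d r < √(4 * d * schDet a b r) := by
  calc schD a b d r = r * (d * ((b - a) / (a + b)) - (a + b) ^ 2) := by rw [schD]; ring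
    _ < r * (√(4 * d) * (a + b)) := mul_lt_mul_of_pos_left hX hr
    _ = √(4 * d * schDet a b r) := by
      rw [schDet, ← mul_pow, Real.sqrt_mul' _ (sq_nonneg _), Real.sqrt_sq (by positivity)]
      ring

theorem trace_schnakenberg_jacobian_neg (hab : a + b ≠ 0) (hr : 0 < r)
    (htr : (b - a) / (a + b) - (a + b) ^ 2 < 0) :
    ((schnakenberg a b d r).jacobian (a + b) (b / (a + b) ^ 2)).trace < 0 := by
  rw [trace_schnakenberg_jacobian hab]
  exact mul_neg_of_pos_of_neg hr htr

theorem schnakenberg_turingStable {n : ℕ} (Ω : Set (Space n)) (bc : BoundaryCondition)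
    (hab : 0 < a + b) (hd : 0 < d) (hr : 0 < r) (htr : (b - a) / (a + b) - (a + b) ^ 2 < 0)
    (hX : d * ((b - a) / (a + b)) - (a + b) ^ 2 < √(4 * d) * (a + b)) :
    (schnakenberg a b d r).TuringStable Ω bc (a + b) (b / (a + b) ^ 2) := by
  refine RDSystem.turingStable_of_det_modeMatrix_pos one_pos hd
    (trace_schnakenberg_jacobian_neg hab.ne' hr htr) fun lam hlam => ?_
  rw [det_schnakenberg_modeMatrix hab.ne']
  exact quadratic_pos_of_lt_sqrt hd.le (schDet_pos hab.ne' hr.ne') hlam.nonneg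
    (schD_lt_sqrt_schDet hab hr hX)

theorem schnakenberg_turingUnstable_iff {n : ℕ} (Ω : Set (Space n)) (bc : BoundaryCondition)
    (hab : a + b ≠ 0) (hd : 0 < d) (hr : 0 < r) (htr : (b - a) / (a + b) - (a + b) ^ 2 < 0) :
    (schnakenberg a b d r).TuringUnstable Ω bc (a + b) (b / (a + b) ^ 2) ↔
      ∃ lam : ℝ, IsNegLaplacianEigenvalue Ω bc lam ∧
        betaMinus a b d r < lam ∧ lam < betaPlus a b d r := by
  rw [RDSystem.turingUnstable_iff_exists_det_modeMatrix_neg one_pos hd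
    (trace_schnakenberg_jacobian_neg hab hr htr)
    ((schDet_pos hab hr.ne').trans_eq (det_schnakenberg_jacobian hab).symm)]
  simp only [det_schnakenberg_modeMatrix hab, quadratic_neg_iff hd, betaMinus, betaPlus]

end Schnakenberg

section Ranges

variable {m c d s : ℝ}

theorem mul_div_sub_sq_eq (hc : c ≠ 0) : d * (m / c) - c ^ 2 = (d * m - c ^ 3) / c := by
  field_simp

theorem div_sub_sq_neg_iff (hc : 0 < c) : m / c - c ^ 2 < 0 ↔ m < c ^ 3 := by
  rw [sub_neg, div_lt_iff₀ hc, ← pow_succ]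

theorem neg_div_lt_and_neg_iff (hc : 0 < c) (hd₀ : 0 ≤ d) (hm : m < c ^ 3) :
    (-(s / c) < d * (m / c) - c ^ 2 ∧ d * (m / c) - c ^ 2 < 0) ↔
      max d 1 * m < c ^ 3 ∧ c ^ 3 < d * m + s := by
  have max_mul_lt_iff : max d 1 * m < c ^ 3 ↔ d * m < c ^ 3 := by
    rcases le_total d 1 with hd | hd
    · rw [max_eq_right hd, one_mul]
      refine iff_of_true hm ?_
      rcases le_total m 0 with hm₀ | hm₀
      · exact (mul_nonpos_of_nonneg_of_nonpos hd₀ hm₀).trans_lt (pow_pos hc 3)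
      · exact (mul_le_of_le_one_left hm₀ hd).trans_lt hm
    · rw [max_eq_left hd]
  rw [max_mul_lt_iff, mul_div_sub_sq_eq hc.ne', ← neg_div, div_lt_div_iff_of_pos_right hc,
    div_lt_iff₀ hc, zero_mul, sub_neg, and_comm, neg_lt_sub_iff_lt_add']

theorem div_lt_mul_div_sub_sq_iff (hc : 0 < c) (hm : m < c ^ 3) :
    s / c < d * (m / c) - c ^ 2 ↔ m < c ^ 3 ∧ c ^ 3 < d * m - s := by
  rw [and_iff_right hm, mul_div_sub_sq_eq hc.ne', div_lt_div_iff_of_pos_right hc, lt_sub_comm]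

theorem mul_div_sub_sq_lt_neg_div_iff (hc : 0 < c) (hm : m < c ^ 3) :
    d * (m / c) - c ^ 2 < -(s / c) ↔ max m (d * m + s) < c ^ 3 := by
  rw [max_lt_iff, and_iff_right hm, mul_div_sub_sq_eq hc.ne', ← neg_div,
    div_lt_div_iff_of_pos_right hc, sub_lt_iff_lt_add, neg_add_eq_sub, lt_sub_iff_add_lt]

end Ranges

end TuringRD

theorem theorem5p1_general {n : ℕ} (Ω : Set (Space n)) (bc : BoundaryCondition)
    (a b d r : ℝ) (hab : 0 < a + b) (hd : 0 < d) (hr : 0 < r)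
    (htr : (b - a) / (a + b) - (a + b) ^ 2 < 0) :
    (schnakenberg a b d r).IsSteadyState (a + b) (b / (a + b) ^ 2) ∧
    ((-(√(4 * d) / (r * (a + b))) < d * ((b - a) / (a + b)) - (a + b) ^ 2 ∧
          d * ((b - a) / (a + b)) - (a + b) ^ 2 < 0) ↔
      (max d 1 * (b - a) < (a + b) ^ 3 ∧ (a + b) ^ 3 < d * (b - a) + √(4 * d) / r)) ∧
    (√(4 * d) / (r * (a + b)) < d * ((b - a) / (a + b)) - (a + b) ^ 2 ↔
      (b - a < (a + b) ^ 3 ∧ (a + b) ^ 3 < d * (b - a) - √(4 * d) / r)) ∧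
    (d * ((b - a) / (a + b)) - (a + b) ^ 2 < -(√(4 * d) / (r * (a + b))) ↔
      max (b - a) (d * (b - a) + √(4 * d) / r) < (a + b) ^ 3) ∧
    (d * ((b - a) / (a + b)) - (a + b) ^ 2 < √(4 * d) * (a + b) →
      (schnakenberg a b d r).TuringStable Ω bc (a + b) (b / (a + b) ^ 2)) ∧
    ((schnakenberg a b d r).TuringUnstable Ω bc (a + b) (b / (a + b) ^ 2) ↔
      ∃ lam : ℝ, IsNegLaplacianEigenvalue Ω bc lam ∧
        betaMinus a b d r < lam ∧ lam < betaPlus a b d r) := by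
  have hrange := (div_sub_sq_neg_iff hab).1 htr
  simp only [← div_div (√(4 * d)) r]
  exact ⟨schnakenberg_isSteadyState hab.ne', neg_div_lt_and_neg_iff hab hd.le hrange,
    div_lt_mul_div_sub_sq_iff hab hrange, mul_div_sub_sq_lt_neg_div_iff hab hrange,
    schnakenberg_turingStable Ω bc hab hd hr htr,
    schnakenberg_turingUnstable_iff Ω bc hab.ne' hd hr htr⟩

theorem theorem5p1 {n : ℕ} (hn : 1 ≤ n) (Ω : Set (Space n)) (hΩo : IsOpen Ω)
    (hΩc : IsConnected Ω) (hΩb : Bornology.IsBounded Ω) (bc : BoundaryCondition)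
    (a b d r : ℝ) (hab : 0 < a + b) (hd : 0 < d) (hr : 0 < r)
    (htr : (b - a) / (a + b) - (a + b) ^ 2 < 0) :
    (schnakenberg a b d r).IsSteadyState (a + b) (b / (a + b) ^ 2) ∧
    -- the ranges in polynomial form
    ((-(√(4 * d) / (r * (a + b))) < d * ((b - a) / (a + b)) - (a + b) ^ 2 ∧
          d * ((b - a) / (a + b)) - (a + b) ^ 2 < 0) ↔
      (max d 1 * (b - a) < (a + b) ^ 3 ∧ (a + b) ^ 3 < d * (b - a) + √(4 * d) / r)) ∧
    (√(4 * d) / (r * (a + b)) < d * ((b - a) / (a + b)) - (a + b) ^ 2 ↔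
      (b - a < (a + b) ^ 3 ∧ (a + b) ^ 3 < d * (b - a) - √(4 * d) / r)) ∧
    (d * ((b - a) / (a + b)) - (a + b) ^ 2 < -(√(4 * d) / (r * (a + b))) ↔
      max (b - a) (d * (b - a) + √(4 * d) / r) < (a + b) ^ 3) ∧
    -- stability and instability, for the threshold `√(4d) / (r(a+b))` of the ranges above
    -- and for the threshold `√(4d)(a+b)`, at which the discriminant of `β₋, β₊` vanishes
    ∀ τ : ℝ, (τ = √(4 * d) / (r * (a + b)) ∨ τ = √(4 * d) * (a + b)) →
      ((-τ < d * ((b - a) / (a + b)) - (a + b) ^ 2 ∧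
          d * ((b - a) / (a + b)) - (a + b) ^ 2 < 0) →
        (schnakenberg a b d r).TuringStable Ω bc (a + b) (b / (a + b) ^ 2)) ∧
      ((τ < d * ((b - a) / (a + b)) - (a + b) ^ 2 ∨
          d * ((b - a) / (a + b)) - (a + b) ^ 2 < -τ) →
        ((schnakenberg a b d r).TuringUnstable Ω bc (a + b) (b / (a + b) ^ 2) ↔
          ∃ lam : ℝ, IsNegLaplacianEigenvalue Ω bc lam ∧
            betaMinus a b d r < lam ∧ lam < betaPlus a b d r)) := by
  obtain ⟨hsteady, h₁, h₂, h₃, hstable, hunstable⟩ :=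
    theorem5p1_general Ω bc a b d r hab hd hr htr
  exact ⟨hsteady, h₁, h₂, h₃, fun τ _ =>
    ⟨fun hX => hstable (hX.2.trans (by positivity)), fun _ => hunstable⟩⟩
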